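/- Let $c\ge 2$ be a real number. For each integer $n\ge 1$ let $P_n(z)=\sum_{k=0}^n a_{k,n}z^k=a_{n,n}\prod_{k=1}^n(z-\alpha_{k,n})$ be a polynomial with integer coefficients, of exact degree $n$ ($a_{n,n}\ne 0$), all of whose complex zeros $\alpha_{1,n},\dots,\alpha_{n,n}$ are simple and lie in $(0,\infty)$. Let $\Omega=\overline{\mathbb C}\setminus[c-2,c+2]$, and let $\Phi$ be the canonical conformal map of $\Omega$ onto $\{w\in\overline{\mathbb C}:|w|>1\}$ with $\Phi(\infty)=\infty$, that is, $\Phi(z)=\frac12\bigl((z-c)+\sqrt{z-c-2}\,\sqrt{z-c+2}\bigr)$ with principal square roots. Define the generalized Mahler measure of $P_n$ by $$M(P_n)=|a_{n,n}|\prod_{\alpha_{k,n}\in\Omega}|\Phi(\alpha_{k,n})| .$$ If $\lim_{n\to\infty}M(P_n)^{1/n}=1$, then for every integer $m\ge 1$ $$\liminf_{n\to\infty}\frac{|a_{n-m,n}|}{\binom nm}\ \ge\ c^m\ \ge\ 2^m ,$$ where the lower limit is taken in $[-\infty,+\infty]$. -/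

import Mathlib

open Polynomial

/-- The set `ℤₙˢ(E)`: polynomials with integer coefficients, of exact degree `n`, all of whose complex
zeros lie in `E` and are simple. -/
def simpleZeroIntPolys (n : ℕ) (E : Set ℂ) : Set ℤ[X] :=
  {P | P.degree = (n : WithBot ℕ) ∧
    (∀ z ∈ (P.map (Int.castRingHom ℂ)).roots, z ∈ E) ∧
    (P.map (Int.castRingHom ℂ)).roots.Nodup}

/-- The open half-line `ℝ₊ = (0, ∞)`, as a subset of the complex plane. -/
def posRealAxis : Set ℂ := Complex.ofReal '' Set.Ioi 0

/-- The segment `[c - 2, c + 2]` of the real line, as a subset of the complex plane. -/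
def realSegment (c : ℝ) : Set ℂ := Complex.ofReal '' Set.Icc (c - 2) (c + 2)

/-- The canonical conformal map `Φ` of the complement of `[c - 2, c + 2]` onto the exterior of the
closed unit disk with `Φ(∞) = ∞`, namely `Φ(z) = (u + √(u - 2) √(u + 2)) / 2` where `u = z - c` and the
roots are principal; see `exteriorMap_conformal`. -/
noncomputable def exteriorMap (c : ℝ) (z : ℂ) : ℂ :=
  ((z - c) + (z - c - 2) ^ (1 / 2 : ℂ) * (z - c + 2) ^ (1 / 2 : ℂ)) / 2

open Classical in
/-- The generalized Mahler measure relative to `[c - 2, c + 2]` of `P = a ∏ (z - αₖ)`: the product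
of `|a|` and of the `|Φ(αₖ)|` over those zeros `αₖ`, counted with multiplicity, that lie outside of
`[c - 2, c + 2]`. -/
noncomputable def segmentMahlerMeasure (c : ℝ) (P : ℂ[X]) : ℝ :=
  ‖P.leadingCoeff‖ *
    ((P.roots.filter (fun z => z ∉ realSegment c)).map (fun z => ‖exteriorMap c z‖)).prod

theorem sq_cpow_half (x : ℂ) : (x ^ (1 / 2 : ℂ)) ^ 2 = x := by
  have := Complex.cpow_nat_inv_pow x (n := 2) two_ne_zero
  simpa only [one_div, Nat.cast_ofNat] using this

theorem exteriorMap_add_inv (c : ℝ) (z : ℂ) :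
    exteriorMap c z * (z - c - exteriorMap c z) = 1 := by
  have h1 := sq_cpow_half (z - c - 2)
  have h2 := sq_cpow_half (z - c + 2)
  unfold exteriorMap
  generalize (z - c - 2) ^ (1 / 2 : ℂ) = a at *
  generalize (z - c + 2) ^ (1 / 2 : ℂ) = b at *
  have : (a * b) ^ 2 = (z - c - 2) * (z - c + 2) := by rw [mul_pow, h1, h2]
  linear_combination (-1 / 4) * this

theorem mem_realSegment_of_joukowski {c : ℝ} {z w : ℂ} (h : w * (z - c - w) = 1) (hw : ‖w‖ = 1) :
    z ∈ realSegment c := by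
  have hw0 : w ≠ 0 := by rintro rfl; simp at hw
  have hi : w⁻¹ = (starRingEnd ℂ) w := by
    rw [Complex.inv_def, Complex.normSq_eq_norm_sq, hw]; simp
  have h1 : z = c + (w + w⁻¹) := by field_simp; linear_combination h
  rw [hi, Complex.add_conj] at h1
  have h2 := abs_le.1 ((Complex.abs_re_le_norm w).trans hw.le)
  refine ⟨c + 2 * w.re, ⟨by linarith, by linarith⟩, ?_⟩
  rw [h1]; push_cast; ring

theorem not_mem_realSegment_of_joukowski {c : ℝ} {z w : ℂ} (h : w * (z - c - w) = 1)
    (hw : 1 < ‖w‖) : z ∉ realSegment c := by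
  rintro ⟨x, ⟨hx1, hx2⟩, rfl⟩
  have hn : 1 < w.re * w.re + w.im * w.im := by
    have := Complex.normSq_eq_norm_sq w
    rw [Complex.normSq_apply] at this
    rw [this]; nlinarith
  have hr := congrArg Complex.re h
  have hi := congrArg Complex.im h
  simp at hr hi
  by_cases h0 : w.im = 0
  · rw [h0] at hr hn
    have ha : (x - c) ^ 2 ≤ 4 := by nlinarith
    nlinarith [sq_nonneg (w.re - 1), sq_nonneg (w.re + 1), sq_nonneg (2 * w.re - (x - c))]
  · have : x - c - w.re = w.re := by
      apply mul_left_cancel₀ h0; linarith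
    rw [this] at hr
    nlinarith

theorem cpow_half_signs (x : ℂ) :
    0 ≤ (x ^ (1 / 2 : ℂ)).re ∧ (0 ≤ x.im → 0 ≤ (x ^ (1 / 2 : ℂ)).im) := by
  by_cases hx : x = 0
  · subst hx; simp
  have him : (Complex.log x * (1 / 2 : ℂ)).im = x.arg / 2 := by
    simp [Complex.log_im]; ring
  have h1 := Complex.neg_pi_lt_arg x
  have h2 := Complex.arg_le_pi x
  rw [Complex.cpow_def_of_ne_zero hx, Complex.exp_re, Complex.exp_im, him]
  refine ⟨mul_nonneg (Real.exp_pos _).le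
    (Real.cos_nonneg_of_neg_pi_div_two_le_of_le (by linarith) (by linarith)), fun h => ?_⟩
  have h3 := Complex.arg_nonneg_iff.2 h
  exact mul_nonneg (Real.exp_pos _).le
    (Real.sin_nonneg_of_nonneg_of_le_pi (by linarith) (by linarith [Real.pi_pos]))

theorem norm_sub_le_norm_add_sqrt (u : ℂ) :
    ‖(u - 2) ^ (1 / 2 : ℂ) - (u + 2) ^ (1 / 2 : ℂ)‖ ≤
      ‖(u - 2) ^ (1 / 2 : ℂ) + (u + 2) ^ (1 / 2 : ℂ)‖ := by
  obtain ⟨ha, ha'⟩ := cpow_half_signs (u - 2)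
  obtain ⟨hb, hb'⟩ := cpow_half_signs (u + 2)
  have h1 := congrArg Complex.im (sq_cpow_half (u - 2))
  have h2 := congrArg Complex.im (sq_cpow_half (u + 2))
  generalize (u - 2) ^ (1 / 2 : ℂ) = a at *
  generalize (u + 2) ^ (1 / 2 : ℂ) = b at *
  simp [pow_two] at h1 h2 ha' hb'
  have key : 0 ≤ a.re * b.re + a.im * b.im := by
    by_cases h0 : u.im = 0
    · have := mul_nonneg ha hb
      have := mul_nonneg (ha' h0.ge) (hb' h0.ge)
      linarith
    · have h3 : 0 < u.im * u.im := mul_self_pos.2 h0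
      have h4 : (a.re * b.re) * (a.im * b.im) * 4 = u.im * u.im := by
        nth_rewrite 1 [← h1]; rw [← h2]; ring
      have h5 : 0 ≤ a.re * b.re := mul_nonneg ha hb
      have h6 : 0 < a.im * b.im := by
        by_contra h
        nlinarith
      linarith
  rw [Complex.norm_def, Complex.norm_def]
  apply Real.sqrt_le_sqrt
  simp only [Complex.normSq_apply, Complex.add_re, Complex.add_im, Complex.sub_re, Complex.sub_im]
  nlinarith

theorem one_lt_norm_exteriorMap {c : ℝ} {z : ℂ} (hz : z ∉ realSegment c) :
    1 < ‖exteriorMap c z‖ := by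
  have h := exteriorMap_add_inv c z
  have hne : ‖exteriorMap c z‖ ≠ 1 := fun h1 => hz (mem_realSegment_of_joukowski h h1)
  have h1 := norm_sub_le_norm_add_sqrt (z - c)
  have h2 := sq_cpow_half (z - c - 2)
  have h3 := sq_cpow_half (z - c + 2)
  have hle : ‖z - c - exteriorMap c z‖ ≤ ‖exteriorMap c z‖ := by
    unfold exteriorMap
    generalize (z - c - 2) ^ (1 / 2 : ℂ) = a at *
    generalize (z - c + 2) ^ (1 / 2 : ℂ) = b at *
    have e1 : z - c - ((z - c) + a * b) / 2 = (a - b) ^ 2 / 4 := by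
      linear_combination (-1 / 4) * h2 + (-1 / 4) * h3
    have e2 : ((z - c) + a * b) / 2 = (a + b) ^ 2 / 4 := by
      linear_combination (-1 / 4) * h2 + (-1 / 4) * h3
    rw [e1, e2, norm_div, norm_div, norm_pow, norm_pow]
    gcongr
  have h4 : ‖exteriorMap c z‖ * ‖z - c - exteriorMap c z‖ = 1 := by
    rw [← norm_mul, h, norm_one]
  refine lt_of_le_of_ne ?_ hne.symm
  by_contra h5
  nlinarith [norm_nonneg (exteriorMap c z), norm_nonneg (z - c - exteriorMap c z)]

theorem joukowski_unique {c : ℝ} {z v w : ℂ} (hv : v * (z - c - v) = 1) (hw : w * (z - c - w) = 1)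
    (hv1 : 1 < ‖v‖) (hw1 : 1 < ‖w‖) : v = w := by
  have h : (v - w) * (v * w - 1) = 0 := by
    linear_combination v * hw - w * hv
  rcases mul_eq_zero.1 h with h | h
  · exact sub_eq_zero.1 h
  · have : ‖v‖ * ‖w‖ = 1 := by rw [← norm_mul, sub_eq_zero.1 h, norm_one]
    nlinarith

theorem exteriorMap_reflect {c : ℝ} {z : ℂ} (hz : z ∉ realSegment c) :
    exteriorMap c z = -exteriorMap c (2 * c - z) := by
  have hz' : 2 * (c : ℂ) - z ∉ realSegment c := by
    rintro ⟨x, ⟨h1, h2⟩, h⟩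
    refine hz ⟨2 * c - x, ⟨by linarith, by linarith⟩, ?_⟩
    push_cast; linear_combination -h
  refine joukowski_unique (exteriorMap_add_inv c z) ?_ (one_lt_norm_exteriorMap hz)
    (by rw [norm_neg]; exact one_lt_norm_exteriorMap hz')
  linear_combination exteriorMap_add_inv c (2 * c - z)

theorem isClosed_realSegment (c : ℝ) : IsClosed (realSegment c) :=
  (isCompact_Icc.image Complex.continuous_ofReal).isClosed

theorem differentiableAt_exteriorMap_aux {c : ℝ} {z : ℂ} (hz : z - c - 2 ∈ Complex.slitPlane) :
    DifferentiableAt ℂ (exteriorMap c) z := by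
  have hz' : z - c + 2 ∈ Complex.slitPlane := by
    rw [Complex.mem_slitPlane_iff] at *
    simp at *
    rcases hz with h | h
    · left; linarith
    · right; exact h
  unfold exteriorMap
  refine DifferentiableAt.div_const (DifferentiableAt.add (by fun_prop) (DifferentiableAt.mul ?_ ?_)) _
  · exact DifferentiableAt.cpow (by fun_prop) (by fun_prop) hz
  · exact DifferentiableAt.cpow (by fun_prop) (by fun_prop) hz'

/-- `exteriorMap c` is a holomorphic bijection of the complement of `[c - 2, c + 2]` onto the exterior of
the closed unit disk, it fixes `∞`, and it has derivative `1 > 0` there. -/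
theorem exteriorMap_conformal (c : ℝ) :
    DifferentiableOn ℂ (exteriorMap c) (realSegment c)ᶜ ∧
    Set.BijOn (exteriorMap c) (realSegment c)ᶜ {w : ℂ | 1 < ‖w‖} ∧
    Filter.Tendsto (exteriorMap c) (Bornology.cobounded ℂ) (Bornology.cobounded ℂ) ∧
    Filter.Tendsto (fun z => exteriorMap c z / z) (Bornology.cobounded ℂ) (nhds 1) := by
  have hb : ∀ z ∈ (realSegment c)ᶜ, ‖exteriorMap c z - z‖ ≤ 1 + |c| := fun z hz => by
    have h1 := one_lt_norm_exteriorMap hz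
    have h2 : ‖exteriorMap c z‖ * ‖z - c - exteriorMap c z‖ = 1 := by
      rw [← norm_mul, exteriorMap_add_inv, norm_one]
    have h3 : ‖z - c - exteriorMap c z‖ ≤ 1 := by
      nlinarith [norm_nonneg (z - c - exteriorMap c z)]
    have h4 : exteriorMap c z - z = -(z - c - exteriorMap c z) - c := by ring
    rw [h4]
    refine (norm_sub_le _ _).trans ?_
    rw [norm_neg, Complex.norm_real, Real.norm_eq_abs]
    linarith
  have hev : ∀ᶠ z in Bornology.cobounded ℂ, ‖exteriorMap c z - z‖ ≤ 1 + |c| := by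
    have hbd : Bornology.IsBounded (realSegment c) :=
      (isCompact_Icc.image Complex.continuous_ofReal).isBounded
    filter_upwards [Bornology.isBounded_def.1 hbd] with z hz using hb z hz
  have hlim : Filter.Tendsto (fun z => exteriorMap c z / z) (Bornology.cobounded ℂ) (nhds 1) := by
    have h0 : Filter.Tendsto (fun z => (exteriorMap c z - z) * z⁻¹) (Bornology.cobounded ℂ)
        (nhds 0) := by
      have h5 : Filter.Tendsto (fun z : ℂ => z⁻¹) (Bornology.cobounded ℂ) (nhds 0) :=
        Filter.tendsto_inv₀_cobounded
      refine squeeze_zero_norm' (a := fun z : ℂ => (1 + |c|) * ‖z⁻¹‖) ?_ ?_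
      · filter_upwards [hev] with z hz
        rw [norm_mul]
        gcongr
      · simpa using (h5.norm).const_mul (1 + |c|)
    have h6 := h0.add_const 1
    rw [zero_add] at h6
    refine h6.congr' ?_
    filter_upwards [Bornology.eventually_ne_cobounded (0 : ℂ)] with z hz
    field_simp
    ring
  refine ⟨fun z hz => ?_, ⟨fun z hz => one_lt_norm_exteriorMap hz, ?_, ?_⟩, ?_, hlim⟩
  · apply DifferentiableAt.differentiableWithinAt
    by_cases h : z - c - 2 ∈ Complex.slitPlane
    · exact differentiableAt_exteriorMap_aux h
    · have h' : (2 * c - z) - c - 2 ∈ Complex.slitPlane := by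
        rw [Complex.mem_slitPlane_iff] at *
        push Not at h
        obtain ⟨h1, h2⟩ := h
        simp at h1 h2 ⊢
        left
        by_contra h3
        exact hz ⟨z.re, ⟨by linarith, by linarith⟩, Complex.ext (by simp) (by simp [h2])⟩
      have hd : DifferentiableAt ℂ (fun z => -exteriorMap c (2 * c - z)) z := by
        have h7 := differentiableAt_exteriorMap_aux h'
        exact (DifferentiableAt.comp (f := fun z => 2 * (c : ℂ) - z) z h7 (by fun_prop)).neg
      refine hd.congr_of_eventuallyEq ?_
      filter_upwards [(isClosed_realSegment c).isOpen_compl.mem_nhds hz] with y hy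
      exact exteriorMap_reflect hy
  · intro z hz w hw hzw
    have h1 := exteriorMap_add_inv c z
    have h2 := exteriorMap_add_inv c w
    rw [← hzw] at h2
    have h3 : exteriorMap c z ≠ 0 := fun h => by simp [h] at h1
    have h4 := mul_left_cancel₀ h3 (h1.trans h2.symm)
    linear_combination h4
  · intro w hw
    have hw0 : w ≠ 0 := by rintro rfl; simp at hw; linarith
    have h : w * ((c + w + w⁻¹) - c - w) = 1 := by field_simp; ring
    have hz := not_mem_realSegment_of_joukowski h hw
    exact ⟨c + w + w⁻¹, hz,
      joukowski_unique (exteriorMap_add_inv c _) h (one_lt_norm_exteriorMap hz) hw⟩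
  · rw [← tendsto_norm_atTop_iff_cobounded]
    refine Filter.tendsto_atTop_mono' _ ?_
      (Filter.tendsto_atTop_add_const_right _ (-(1 + |c|)) tendsto_norm_cobounded_atTop)
    filter_upwards [hev] with z hz
    have := norm_sub_norm_le z (exteriorMap c z)
    rw [norm_sub_rev] at this
    linarith

/-!
Write `Φ = exteriorMap c`. Every `z` is `c + Φ + ζ` with `ζ = 1 / Φ = z - c - Φ` in the closed unit
disk, and `2 Re ζ = z - c` when `z` lies in the segment. The proof shows that the mean of `Re ζ` over
the zeros of `P n` tends to `0`, which is the only consequence of equidistribution that is needed.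

The resultant of `P` and `P'` is a nonzero integer, so that the logarithm of `∏ |zᵢ - zⱼ|` over
`i ≠ j` is at least `-(2 n - 1) log |aₙ|` (`one_le_norm_leadingCoeff_pow_mul_prod`).
On the other hand, for `0 ≤ r < 1`, the Schwarz-Pick inequality gives
`|zᵢ - zⱼ| ≤ |Φᵢ| |Φⱼ| (2 / (1 + r))² |1 - r ζᵢ ζ̄ⱼ| |1 - r ζᵢ ζⱼ|` (`norm_sub_le_of_mul_eq_one`).
The factor `|Φᵢ|` is accounted for by the Mahler measure, and the kernel
`-log (|1 - r ζ η̄| |1 - r ζ η|) = ∑ (2 r ^ k / k) Re (ζ ^ k) Re (η ^ k)` is positive definite;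
keeping
its term `k = 1` bounds the sum of the logarithms of the last factors over all pairs by
`-2 r (∑ Re ζᵢ)²` (`sum_log_norm_le`). With `r = 1 - 1 / n` the comparison yields
`((∑ Re ζᵢ) / n)² ≤ 2 (log M + 1 + log n) / n` (`sq_sum_re_div_le`), which tends to `0`.

The numbers `b z = min z (c + 2)` satisfy `b z ≥ c + 2 Re ζ - (c + 2) log |Φ|`
(`add_two_mul_re_sub_le_min`), so their mean has lower limit at least `c`. Since they lie in the fixed
interval `[0, c + 2]`, the `m`-th elementary symmetric sum of the `b z` is at least
`∏ j < m, (∑ b z - j (c + 2)) / m!` (`prod_sum_sub_le_factorial_mul`), hence asymptotically at least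
`c ^ m` times `n.choose m`. By Vieta's formulas and `|aₙ| ≥ 1` it is a lower bound for `|aₙ₋ₘ|`.
-/

/-! ### Elementary symmetric sums of bounded numbers -/

/-- For `0 ≤ bᵢ ≤ T`, consecutive elementary symmetric sums satisfy `(e₁ - k T) eₖ ≤ (k + 1) eₖ₊₁`:
in `e₁ eₖ`, the products with a repeated index contribute at most `k T eₖ`. -/
theorem sum_sub_mul_sum_powersetCard_le {ι : Type*} {b : ι → ℝ} {T : ℝ} (s : Finset ι)
    (h0 : ∀ i ∈ s, 0 ≤ b i) (hT : ∀ i ∈ s, b i ≤ T) (k : ℕ) :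
    (∑ i ∈ s, b i - k * T) * ∑ t ∈ s.powersetCard k, ∏ i ∈ t, b i ≤
      (k + 1) * ∑ t ∈ s.powersetCard (k + 1), ∏ i ∈ t, b i := by
  classical
  induction s using Finset.induction_on generalizing k with
  | empty =>
    have h (k : ℕ) : (∅ : Finset ι).powersetCard (k + 1) = ∅ :=
      Finset.powersetCard_eq_empty.2 (by simp)
    cases k <;> simp [h]
  | insert x s hx ih =>
    have h0' : ∀ i ∈ s, 0 ≤ b i := fun i hi => h0 i (Finset.mem_insert_of_mem hi)
    have hT' : ∀ i ∈ s, b i ≤ T := fun i hi => hT i (Finset.mem_insert_of_mem hi)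
    have hx0 := h0 x (Finset.mem_insert_self _ _)
    have hxT := hT x (Finset.mem_insert_self _ _)
    have hrec : ∀ k, ∑ t ∈ (insert x s).powersetCard (k + 1), ∏ i ∈ t, b i =
        ∑ t ∈ s.powersetCard (k + 1), ∏ i ∈ t, b i +
          b x * ∑ t ∈ s.powersetCard k, ∏ i ∈ t, b i := by
      intro k
      rw [Finset.powersetCard_succ_insert hx, Finset.sum_union, Finset.sum_image, Finset.mul_sum]
      · congr 1
        refine Finset.sum_congr rfl fun t ht => Finset.prod_insert fun h => hx ?_
        exact (Finset.mem_powersetCard.1 ht).1 h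
      · intro t ht u hu h
        have ht' : x ∉ t := fun h => hx ((Finset.mem_powersetCard.1 ht).1 h)
        have hu' : x ∉ u := fun h => hx ((Finset.mem_powersetCard.1 hu).1 h)
        rw [← Finset.erase_insert ht', ← Finset.erase_insert hu', h]
      · rw [Finset.disjoint_left]
        intro t ht h
        obtain ⟨u, -, rfl⟩ := Finset.mem_image.1 h
        exact hx ((Finset.mem_powersetCard.1 ht).1 (Finset.mem_insert_self _ _))
    have nn : ∀ k, 0 ≤ ∑ t ∈ s.powersetCard k, ∏ i ∈ t, b i := fun k =>
      Finset.sum_nonneg fun t ht => Finset.prod_nonneg fun i hi =>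
        h0' i ((Finset.mem_powersetCard.1 ht).1 hi)
    rw [hrec, Finset.sum_insert hx]
    have ih1 := ih h0' hT' k
    cases k with
    | zero => simp [Finset.powersetCard_one, Finset.sum_map] at ih1 ⊢; linarith
    | succ k =>
      have ih2 := ih h0' hT' k
      rw [hrec]
      push_cast at *
      have := mul_nonneg (mul_nonneg hx0 (sub_nonneg.2 hxT)) (nn k)
      nlinarith [mul_le_mul_of_nonneg_left ih2 hx0]

theorem prod_sum_sub_le_factorial_mul {ι : Type*} {b : ι → ℝ} {T : ℝ} (s : Finset ι)
    (h0 : ∀ i ∈ s, 0 ≤ b i) (hT : ∀ i ∈ s, b i ≤ T) (m : ℕ)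
    (hS : ∀ j < m, 0 ≤ ∑ i ∈ s, b i - j * T) :
    ∏ j ∈ Finset.range m, (∑ i ∈ s, b i - j * T) ≤
      m.factorial * ∑ t ∈ s.powersetCard m, ∏ i ∈ t, b i := by
  induction m with
  | zero => simp
  | succ m ih =>
    rw [Finset.prod_range_succ]
    calc _ ≤ (m.factorial * ∑ t ∈ s.powersetCard m, ∏ i ∈ t, b i) * (∑ i ∈ s, b i - m * T) :=
          mul_le_mul_of_nonneg_right (ih fun j hj => hS j (by omega)) (hS m (by omega))
      _ = m.factorial * ((∑ i ∈ s, b i - m * T) * ∑ t ∈ s.powersetCard m, ∏ i ∈ t, b i) := by ring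
      _ ≤ m.factorial * ((m + 1) * ∑ t ∈ s.powersetCard (m + 1), ∏ i ∈ t, b i) := by
          exact mul_le_mul_of_nonneg_left (sum_sub_mul_sum_powersetCard_le s h0 hT m)
            (Nat.cast_nonneg _)
      _ = _ := by push_cast [Nat.factorial_succ]; ring

/-! ### The logarithmic energy of points of the closed unit disk -/

/-- The Schwarz-Pick inequality: a Blaschke factor is at most `1` in modulus on the closed disk. -/
theorem norm_sub_le_norm_one_sub_mul_conj {z w : ℂ} (hz : ‖z‖ ≤ 1) (hw : ‖w‖ ≤ 1) :
    ‖z - w‖ ≤ ‖1 - z * starRingEnd ℂ w‖ := by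
  rw [← sq_le_sq₀ (norm_nonneg _) (norm_nonneg _)]
  have h1 : ‖z‖ ^ 2 ≤ 1 := pow_le_one₀ (norm_nonneg _) hz
  have h2 : ‖w‖ ^ 2 ≤ 1 := pow_le_one₀ (norm_nonneg _) hw
  have h3 := mul_nonneg (sub_nonneg.2 h1) (sub_nonneg.2 h2)
  simp only [← Complex.normSq_eq_norm_sq, Complex.normSq_apply] at h3 ⊢
  simp
  nlinarith

/-- Equality holds at `z = -1`, where `‖1 - z‖ / ‖1 - r z‖` attains its maximum over the disk. -/
theorem one_add_mul_norm_one_sub_le {z : ℂ} (hz : ‖z‖ ≤ 1) {r : ℝ} (h0 : 0 ≤ r) (h1 : r ≤ 1) :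
    (1 + r) * ‖1 - z‖ ≤ 2 * ‖1 - r * z‖ := by
  rw [← sq_le_sq₀ (by positivity) (by positivity), mul_pow, mul_pow]
  have h2 : ‖z‖ ^ 2 ≤ 1 := pow_le_one₀ (norm_nonneg _) hz
  have h3 := (abs_le.1 ((Complex.abs_re_le_norm z).trans hz)).1
  simp only [← Complex.normSq_eq_norm_sq, Complex.normSq_apply] at h2 ⊢
  simp
  have h4 : 0 ≤ (1 - r) * ((3 + r) + 2 * (1 - r) * z.re
      - (z.re * z.re + z.im * z.im) * (3 * r + 1)) := by
    refine mul_nonneg (by linarith) ?_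
    nlinarith [mul_nonneg (sub_nonneg.2 h1) (show (0 : ℝ) ≤ z.re + 1 by linarith),
      mul_nonneg (show (0 : ℝ) ≤ 3 * r + 1 by linarith) (sub_nonneg.2 h2)]
  nlinarith

/-- Distances of points `v + z` with `z = v⁻¹` in the closed unit disk, bounded by a kernel whose
logarithm stays finite on the diagonal when `r < 1`. -/
theorem norm_sub_le_of_mul_eq_one {v w z y : ℂ} (hv : v * z = 1) (hw : w * y = 1)
    (hz : ‖z‖ ≤ 1) (hy : ‖y‖ ≤ 1) {r : ℝ} (h0 : 0 ≤ r) (h1 : r ≤ 1) :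
    ‖(v + z) - (w + y)‖ ≤ ‖v‖ * ‖w‖ * (2 / (1 + r)) ^ 2 *
      (‖1 - r * (z * starRingEnd ℂ y)‖ * ‖1 - r * (z * y)‖) := by
  have e : (v + z) - (w + y) = v * w * ((y - z) * (1 - z * y)) := by
    linear_combination (w + w * y * (y - z)) * hv + (y - z - v) * hw
  have aux : ∀ x : ℂ, ‖x‖ ≤ 1 → ‖1 - x‖ ≤ 2 / (1 + r) * ‖1 - r * x‖ := fun x hx => by
    rw [div_mul_eq_mul_div, le_div_iff₀ (by linarith), mul_comm]
    exact one_add_mul_norm_one_sub_le hx h0 h1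
  have hb : ‖z * y‖ ≤ 1 := by
    rw [norm_mul]; exact mul_le_one₀ hz (norm_nonneg _) hy
  have hb' : ‖z * starRingEnd ℂ y‖ ≤ 1 := by
    rw [norm_mul, RCLike.norm_conj]; exact mul_le_one₀ hz (norm_nonneg _) hy
  rw [e, norm_mul, norm_mul, norm_mul, norm_sub_rev y z]
  calc _ ≤ ‖v‖ * ‖w‖ * ((2 / (1 + r) * ‖1 - r * (z * starRingEnd ℂ y)‖) *
        (2 / (1 + r) * ‖1 - r * (z * y)‖)) := by
        gcongr
        · exact (norm_sub_le_norm_one_sub_mul_conj hz hy).trans (aux _ hb')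
        · exact aux _ hb
    _ = _ := by ring

theorem one_sub_le_norm_one_sub_mul {z : ℂ} (hz : ‖z‖ ≤ 1) {r : ℝ} (h0 : 0 ≤ r) :
    1 - r ≤ ‖1 - r * z‖ := by
  have h := norm_sub_norm_le (1 : ℂ) (r * z)
  rw [norm_one, norm_mul, Complex.norm_real, Real.norm_of_nonneg h0] at h
  nlinarith

theorem hasSum_neg_log_norm_one_sub {z : ℂ} (hz : ‖z‖ < 1) :
    HasSum (fun k : ℕ => (z ^ k).re / k) (-Real.log ‖1 - z‖) := by
  have h := Complex.hasSum_re (Complex.hasSum_taylorSeries_neg_log hz)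
  rw [Complex.neg_re, Complex.log_re] at h
  simpa only [Complex.div_natCast_re] using h

/-- The kernel `-log (‖1 - r z w̄‖ ‖1 - r z w‖)` is positive definite, its expansion being
`∑ (2 r ^ k / k) Re (z ^ k) Re (w ^ k)`; the bound keeps only the term `k = 1`. -/
theorem sum_log_norm_le {ι : Type*} (s : Finset ι) {f : ι → ℂ} (hf : ∀ i ∈ s, ‖f i‖ ≤ 1) {r : ℝ}
    (h0 : 0 ≤ r) (h1 : r < 1) :
    ∑ i ∈ s, ∑ j ∈ s, Real.log (‖1 - r * (f i * starRingEnd ℂ (f j))‖ * ‖1 - r * (f i * f j)‖) ≤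
      -(2 * r * (∑ i ∈ s, (f i).re) ^ 2) := by
  have hb : ∀ i ∈ s, ∀ j ∈ s, ‖f i * f j‖ ≤ 1 := fun i hi j hj => by
    rw [norm_mul]; exact mul_le_one₀ (hf i hi) (norm_nonneg _) (hf j hj)
  have hb' : ∀ i ∈ s, ∀ j ∈ s, ‖f i * starRingEnd ℂ (f j)‖ ≤ 1 := fun i hi j hj => by
    rw [norm_mul, RCLike.norm_conj, ← norm_mul]; exact hb i hi j hj
  have hlt : ∀ z : ℂ, ‖z‖ ≤ 1 → ‖(r : ℂ) * z‖ < 1 := fun z hz => by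
    rw [norm_mul, Complex.norm_real, Real.norm_of_nonneg h0]
    nlinarith [norm_nonneg z]
  -- The power series of `log (1 - z)`, summed over all pairs of points.
  have hS : HasSum (fun k : ℕ => ∑ i ∈ s, ∑ j ∈ s,
      ((((r * (f i * starRingEnd ℂ (f j))) ^ k).re / k) + ((r * (f i * f j)) ^ k).re / k))
      (∑ i ∈ s, ∑ j ∈ s, -Real.log (‖1 - r * (f i * starRingEnd ℂ (f j))‖ *
        ‖1 - r * (f i * f j)‖)) := by
    refine hasSum_sum fun i hi => hasSum_sum fun j hj => ?_
    have p1 := one_sub_le_norm_one_sub_mul (hb i hi j hj) h0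
    have p2 := one_sub_le_norm_one_sub_mul (hb' i hi j hj) h0
    rw [Real.log_mul (by linarith) (by linarith), neg_add]
    exact (hasSum_neg_log_norm_one_sub (hlt _ (hb' i hi j hj))).add
      (hasSum_neg_log_norm_one_sub (hlt _ (hb i hi j hj)))
  -- `Re (z w̄) + Re (z w) = 2 Re z Re w`, applied to `k`-th powers, turns each term into a square.
  -- At `k = 0` both sides vanish, because of the division by `0`.
  have hterm : ∀ k : ℕ, ∑ i ∈ s, ∑ j ∈ s,
      ((((r * (f i * starRingEnd ℂ (f j))) ^ k).re / k) + ((r * (f i * f j)) ^ k).re / k) =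
      2 * r ^ k / k * (∑ i ∈ s, (f i ^ k).re) ^ 2 := by
    intro k
    rw [sq, Finset.sum_mul_sum, Finset.mul_sum]
    refine Finset.sum_congr rfl fun i _ => ?_
    rw [Finset.mul_sum]
    refine Finset.sum_congr rfl fun j _ => ?_
    rw [mul_pow, mul_pow, mul_pow, mul_pow, ← map_pow, ← Complex.ofReal_pow, Complex.re_ofReal_mul,
      Complex.re_ofReal_mul, Complex.mul_re, Complex.mul_re, Complex.conj_re, Complex.conj_im]
    ring
  simp_rw [hterm] at hS
  have := le_hasSum hS 1 fun k _ => by positivity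
  simp only [Finset.sum_neg_distrib] at this
  simp at this
  linarith

/-! ### Integrality of the discriminant -/

theorem natDegree_map_intCast {P : ℤ[X]} {n : ℕ} (hn : P.degree = n) :
    (P.map (Int.castRingHom ℂ)).natDegree = n := by
  rw [natDegree_map_eq_of_injective (RingHom.injective_int _), natDegree_eq_of_degree_eq_some hn]

theorem one_le_norm_leadingCoeff_map {P : ℤ[X]} (hP : P ≠ 0) :
    1 ≤ ‖(P.map (Int.castRingHom ℂ)).leadingCoeff‖ := by
  rw [leadingCoeff_map_of_injective (RingHom.injective_int _)]
  refine le_of_le_of_eq ?_ (Complex.norm_intCast _).symm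
  exact_mod_cast Int.one_le_abs (leadingCoeff_ne_zero.2 hP)

theorem card_toFinset_roots_map {P : ℤ[X]} {n : ℕ} (hn : P.degree = n)
    (hd : (P.map (Int.castRingHom ℂ)).roots.Nodup) :
    (P.map (Int.castRingHom ℂ)).roots.toFinset.card = n := by
  rw [Multiset.toFinset_card_of_nodup hd,
    ← (IsAlgClosed.splits (P.map (Int.castRingHom ℂ))).natDegree_eq_card_roots,
    natDegree_map_intCast hn]

/-- The right-hand side is the modulus of the resultant of `P` and `P'`, a nonzero integer. This is the
discriminant up to sign and one more power of the leading coefficient. -/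
theorem one_le_norm_leadingCoeff_pow_mul_prod {P : ℤ[X]} {n : ℕ} (hn : P.degree = n) (hn1 : 1 ≤ n)
    (hd : (P.map (Int.castRingHom ℂ)).roots.Nodup) :
    1 ≤ ‖(P.map (Int.castRingHom ℂ)).leadingCoeff‖ ^ (2 * n - 1) *
      ∏ z ∈ (P.map (Int.castRingHom ℂ)).roots.toFinset,
        ∏ w ∈ (P.map (Int.castRingHom ℂ)).roots.toFinset.erase z, ‖z - w‖ := by
  have hnat : (P.map (Int.castRingHom ℂ)).natDegree = n := natDegree_map_intCast hn
  have hcard := card_toFinset_roots_map hn hd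
  have hsplit := IsAlgClosed.splits (P.map (Int.castRingHom ℂ))
  set Q := P.map (Int.castRingHom ℂ) with hQ
  have hQ0 : Q ≠ 0 := by rintro h; rw [h] at hnat; simp at hnat; omega
  have hval : Q.roots.toFinset.val = Q.roots := by rw [Multiset.toFinset_val, hd.dedup]
  have hev : ∀ z ∈ Q.roots.toFinset, Q.derivative.eval z =
      Q.leadingCoeff * ∏ w ∈ Q.roots.toFinset.erase z, (z - w) := by
    intro z hz
    have hz' := Multiset.mem_toFinset.1 hz
    conv_lhs => rw [hsplit.eq_prod_roots]
    rw [derivative_C_mul, eval_mul, eval_C, eval_multiset_prod_X_sub_C_derivative hz',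
      Finset.prod_eq_multiset_prod, Finset.erase_val, hval]
  have hres : Q.resultant Q.derivative Q.natDegree (n - 1) =
      Q.leadingCoeff ^ (n - 1) * ∏ z ∈ Q.roots.toFinset, Q.derivative.eval z := by
    rw [resultant_eq_prod_eval _ _ _ (by rw [← hnat]; exact natDegree_derivative_le _) hsplit,
      Finset.prod_eq_multiset_prod, hval]
  rw [Finset.prod_congr rfl hev, Finset.prod_mul_distrib, Finset.prod_const,
    hcard, ← mul_assoc, ← pow_add,
    show n - 1 + n = 2 * n - 1 by omega] at hres
  have hint : Q.resultant Q.derivative Q.natDegree (n - 1) =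
      ((P.resultant P.derivative Q.natDegree (n - 1) : ℤ) : ℂ) := by
    rw [hQ, derivative_map, resultant_map_map]; rfl
  have hne : P.resultant P.derivative Q.natDegree (n - 1) ≠ 0 := by
    intro h
    rw [h, hres, Int.cast_zero] at hint
    refine mul_ne_zero (pow_ne_zero _ (leadingCoeff_ne_zero.2 hQ0)) ?_ hint
    exact Finset.prod_ne_zero_iff.2 fun z _ => Finset.prod_ne_zero_iff.2 fun w hw =>
      sub_ne_zero.2 (Finset.ne_of_mem_erase hw).symm
  have h1 : (1 : ℝ) ≤ ‖Q.resultant Q.derivative Q.natDegree (n - 1)‖ := by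
    rw [hint, Complex.norm_intCast]
    exact_mod_cast Int.one_le_abs hne
  rw [hres] at h1
  simpa only [norm_mul, norm_pow, norm_prod] using h1

/-! ### The exterior map at positive real points -/

/-- Here `z - c - exteriorMap c z` is the inverse of `exteriorMap c z`. In contrast to
`one_lt_norm_exteriorMap`, this includes the segment, where the principal roots provide a boundary
value of modulus `1`. -/
theorem norm_sub_exteriorMap_le_one_and (c : ℝ) (z : ℂ) :
    ‖z - c - exteriorMap c z‖ ≤ 1 ∧ 1 ≤ ‖exteriorMap c z‖ ∧
      (z ∈ realSegment c → ‖exteriorMap c z‖ = 1) := by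
  have h := exteriorMap_add_inv c z
  have hn : ‖exteriorMap c z‖ * ‖z - c - exteriorMap c z‖ = 1 := by rw [← norm_mul, h, norm_one]
  have h0 := norm_nonneg (exteriorMap c z)
  have h0' := norm_nonneg (z - c - exteriorMap c z)
  by_cases hz : z ∈ realSegment c
  · have h1 : ‖exteriorMap c z‖ ≤ 1 := not_lt.1 fun h1 => not_mem_realSegment_of_joukowski h h1 hz
    have h2 : ‖z - c - exteriorMap c z‖ ≤ 1 := not_lt.1 fun h1 =>
      not_mem_realSegment_of_joukowski (by linear_combination h) h1 hz
    have h3 : 1 ≤ ‖exteriorMap c z‖ := by nlinarith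
    exact ⟨h2, h3, fun _ => le_antisymm h1 h3⟩
  · have h1 := one_lt_norm_exteriorMap hz
    exact ⟨by nlinarith, h1.le, fun h => absurd h hz⟩

/-- The restriction to the zeros outside of the segment may be dropped, since `‖exteriorMap c z‖ = 1`
on it. -/
theorem segmentMahlerMeasure_eq_prod_roots (c : ℝ) (P : ℂ[X]) :
    segmentMahlerMeasure c P =
      ‖P.leadingCoeff‖ * (P.roots.map fun z => ‖exteriorMap c z‖).prod := by
  classical
  rw [segmentMahlerMeasure]
  congr 1
  conv_rhs => rw [← Multiset.filter_add_not (fun z => z ∈ realSegment c) P.roots]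
  have h1 : ((P.roots.filter (fun z => z ∈ realSegment c)).map
      (fun z => ‖exteriorMap c z‖)).prod = 1 := by
    refine Multiset.prod_eq_one fun x hx => ?_
    obtain ⟨z, hz, rfl⟩ := Multiset.mem_map.1 hx
    exact (norm_sub_exteriorMap_le_one_and c z).2.2 (Multiset.mem_filter.1 hz).2
  rw [Multiset.map_add, Multiset.prod_add, h1, one_mul]

/-- On the segment the left-hand side is `x`. To the right of it `min x (c + 2) - c = 2 ≥ 2 Re ζ`, for
`ζ = x - c - exteriorMap c x`. To the left of it `x > 0` keeps `‖exteriorMap c x‖` below `c + 1`, so that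
the defect `x - c - 2 Re ζ` is controlled by the logarithm. -/
theorem add_two_mul_re_sub_le_min {c x : ℝ} (hc : 0 ≤ c) (hx : 0 < x) :
    c + 2 * ((x : ℂ) - c - exteriorMap c x).re - (c + 2) * Real.log ‖exteriorMap c x‖ ≤
      min x (c + 2) := by
  obtain ⟨hz, hw, -⟩ := norm_sub_exteriorMap_le_one_and c x
  have h := exteriorMap_add_inv c x
  have hn : ‖exteriorMap c x‖ * ‖(x : ℂ) - c - exteriorMap c x‖ = 1 := by
    rw [← norm_mul, h, norm_one]
  set w := exteriorMap c x
  set ζ : ℂ := (x : ℂ) - c - w with hζ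
  set W := ‖w‖
  have hlog := Real.one_sub_inv_le_log_of_pos (zero_lt_one.trans_le hw)
  have hl0 := Real.log_nonneg hw
  have hre := (abs_le.1 (Complex.abs_re_le_norm ζ))
  -- `w` and `ζ` are inverse to each other, so `w = W² ζ̄`, and `x - c = Re w + Re ζ`.
  have hmain : x - c = (1 + W ^ 2) * ζ.re := by
    have h1 : w = W ^ 2 * starRingEnd ℂ ζ := by
      have h2 : w * starRingEnd ℂ w = (W : ℂ) ^ 2 := Complex.mul_conj' w
      have h3 : starRingEnd ℂ w * starRingEnd ℂ ζ = 1 := by rw [← map_mul, h, map_one]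
      linear_combination starRingEnd ℂ ζ * h2 - w * h3
    have h4 := congrArg Complex.re h1
    rw [← Complex.ofReal_pow, Complex.re_ofReal_mul, Complex.conj_re] at h4
    have h5 := congrArg Complex.re hζ
    simp only [Complex.sub_re, Complex.ofReal_re] at h5
    linarith
  refine le_min ?_ (by nlinarith)
  rcases le_or_gt 0 ζ.re with h0 | h0
  · have h1 := mul_nonneg (sub_nonneg.2 (one_le_pow₀ hw : 1 ≤ W ^ 2)) h0
    have h2 := mul_nonneg (show 0 ≤ c + 2 by linarith) hl0
    linarith
  · have hWc : W ≤ c + 1 := by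
      have h1 : ‖((x - c : ℝ) : ℂ) - ζ‖ = W := by
        rw [hζ]; push_cast; congr 1; ring
      have h2 := norm_sub_le ((x - c : ℝ) : ℂ) ζ
      rw [Complex.norm_real, Real.norm_eq_abs, h1] at h2
      have h3 : |x - c| ≤ c := by rw [abs_le]; constructor <;> nlinarith
      linarith
    -- `(W ^ 2 - 1) |Re ζ| ≤ (W ^ 2 - 1) / W = (W + 1) (1 - 1 / W) ≤ (W + 1) log W`
    have hW0 : 0 < W := by linarith
    have hz' : ‖ζ‖ = W⁻¹ := eq_inv_of_mul_eq_one_right hn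
    have h1 : (W ^ 2 - 1) * (-ζ.re) ≤ (W ^ 2 - 1) * W⁻¹ := by
      apply mul_le_mul_of_nonneg_left (by linarith) (by nlinarith)
    have h2 : (W ^ 2 - 1) * W⁻¹ = (W + 1) * (1 - W⁻¹) := by field_simp; ring
    have h3 : (W + 1) * (1 - W⁻¹) ≤ (c + 2) * Real.log W :=
      mul_le_mul (by linarith) hlog (sub_nonneg.2 (inv_le_one_of_one_le₀ hw)) (by linarith)
    nlinarith

/-! ### Equidistribution of the first moment -/

/-- Upper bound for the logarithm of the discriminant product of a finite set of points, in terms of the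
exterior map and of the first moment of its inverses. Outer factors are summed over all pairs,
which only increases them. -/
theorem sum_log_norm_sub_le (c : ℝ) (s : Finset ℂ) {r : ℝ} (h0 : 0 ≤ r) (h1 : r < 1) :
    ∑ z ∈ s, ∑ w ∈ s.erase z, Real.log ‖z - w‖ ≤
      2 * s.card * ∑ z ∈ s, Real.log ‖exteriorMap c z‖
        + 2 * s.card ^ 2 * Real.log (2 / (1 + r)) + 2 * s.card * Real.log (1 - r)⁻¹
        - 2 * r * (∑ z ∈ s, (z - c - exteriorMap c z).re) ^ 2 := by
  set f : ℂ → ℂ := fun z => z - c - exteriorMap c z with hf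
  set W : ℂ → ℝ := fun z => Real.log ‖exteriorMap c z‖ with hW
  set δ : ℝ := Real.log (2 / (1 + r)) with hδ
  set E : ℂ → ℂ → ℝ := fun z w =>
    Real.log (‖1 - r * (f z * starRingEnd ℂ (f w))‖ * ‖1 - r * (f z * f w)‖) with hE
  have hfn : ∀ z, ‖f z‖ ≤ 1 := fun z => (norm_sub_exteriorMap_le_one_and c z).1
  have hwn : ∀ z, 1 ≤ ‖exteriorMap c z‖ := fun z => (norm_sub_exteriorMap_le_one_and c z).2.1
  have hW0 : ∀ z, 0 ≤ W z := fun z => Real.log_nonneg (hwn z)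
  have hδ0 : 0 ≤ δ := Real.log_nonneg (by rw [le_div_iff₀ (by linarith)]; linarith)
  have hb : ∀ z w, 1 - r ≤ ‖1 - r * (f z * f w)‖ := fun z w =>
    one_sub_le_norm_one_sub_mul
      (by rw [norm_mul]; exact mul_le_one₀ (hfn z) (norm_nonneg _) (hfn w)) h0
  have hb' : ∀ z w, 1 - r ≤ ‖1 - r * (f z * starRingEnd ℂ (f w))‖ := fun z w =>
    one_sub_le_norm_one_sub_mul
      (by rw [norm_mul, RCLike.norm_conj]; exact mul_le_one₀ (hfn z) (norm_nonneg _) (hfn w)) h0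
  have hr : 0 < 1 - r := by linarith
  have hpair : ∀ z w, z ≠ w → Real.log ‖z - w‖ ≤ W z + W w + 2 * δ + E z w := by
    intro z w hzw
    have h := norm_sub_le_of_mul_eq_one (exteriorMap_add_inv c z) (exteriorMap_add_inv c w)
      (hfn z) (hfn w) h0 h1.le
    rw [show exteriorMap c z + (z - c - exteriorMap c z) -
      (exteriorMap c w + (w - c - exteriorMap c w)) = z - w by ring] at h
    have h2 := Real.log_le_log (norm_pos_iff.2 (sub_ne_zero.2 hzw)) h
    have p1 := zero_lt_one.trans_le (hwn z)
    have p2 := zero_lt_one.trans_le (hwn w)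
    have p3 := hr.trans_le (hb z w)
    have p4 := hr.trans_le (hb' z w)
    have p5 : 0 < 2 / (1 + r) := by positivity
    rwa [Real.log_mul (by positivity) (mul_pos p4 p3).ne', Real.log_mul (by positivity)
      (by positivity), Real.log_mul p1.ne' p2.ne', Real.log_pow, Nat.cast_ofNat] at h2
  -- The energy bound involves the diagonal as well, which is only of order `log (1 / (1 - r))`.
  have hdiag : ∀ z, -(2 * Real.log (1 - r)⁻¹) ≤ E z z := by
    intro z
    rw [Real.log_inv, mul_neg, neg_neg, ← Nat.cast_ofNat (R := ℝ), ← Real.log_pow, sq]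
    exact Real.log_le_log (by positivity)
      (mul_le_mul (hb' z z) (hb z z) hr.le (norm_nonneg _))
  have hrow : ∀ z ∈ s, ∑ w ∈ s.erase z, Real.log ‖z - w‖ ≤
      ∑ w ∈ s, (W z + W w + 2 * δ + E z w) + 2 * Real.log (1 - r)⁻¹ := by
    intro z hz
    rw [← Finset.sum_erase_add _ _ hz]
    have h := Finset.sum_le_sum fun w (hw : w ∈ s.erase z) =>
      hpair z w (Finset.ne_of_mem_erase hw).symm
    have := hdiag z
    have := hW0 z
    linarith
  refine (Finset.sum_le_sum hrow).trans ?_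
  have hen := sum_log_norm_le s (fun i _ => hfn i) h0 h1
  simp only [Finset.sum_add_distrib, Finset.sum_const, nsmul_eq_mul, ← Finset.mul_sum]
  change ∑ i ∈ s, ∑ j ∈ s, E i j ≤ _ at hen
  linarith

theorem log_segmentMahlerMeasure (c : ℝ) {P : ℂ[X]} (hP : P ≠ 0) (hd : P.roots.Nodup) :
    Real.log (segmentMahlerMeasure c P) = Real.log ‖P.leadingCoeff‖ +
      ∑ z ∈ P.roots.toFinset, Real.log ‖exteriorMap c z‖ := by
  have h : (P.roots.map fun z => ‖exteriorMap c z‖).prod =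
      ∏ z ∈ P.roots.toFinset, ‖exteriorMap c z‖ := by
    rw [Finset.prod_eq_multiset_prod, Multiset.toFinset_val, hd.dedup]
  have hne : ∀ z ∈ P.roots.toFinset, ‖exteriorMap c z‖ ≠ 0 := fun z _ =>
    (zero_lt_one.trans_le (norm_sub_exteriorMap_le_one_and c z).2.1).ne'
  rw [segmentMahlerMeasure_eq_prod_roots, h, Real.log_mul, Real.log_prod hne]
  · simpa using hP
  · exact Finset.prod_ne_zero_iff.2 hne

theorem sq_sum_re_div_le (c : ℝ) {P : ℤ[X]} {n : ℕ} (hn : P.degree = n) (hn2 : 2 ≤ n)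
    (hd : (P.map (Int.castRingHom ℂ)).roots.Nodup) :
    ((∑ z ∈ (P.map (Int.castRingHom ℂ)).roots.toFinset, (z - c - exteriorMap c z).re) / n) ^ 2 ≤
      2 * (Real.log (segmentMahlerMeasure c (P.map (Int.castRingHom ℂ))) / n
        + 1 / n + Real.log n / n) := by
  have hdisc := one_le_norm_leadingCoeff_pow_mul_prod hn (by omega) hd
  have hP0 : P ≠ 0 := by rintro rfl; simp at hn
  have hQ0 : P.map (Int.castRingHom ℂ) ≠ 0 :=
    (Polynomial.map_ne_zero_iff (RingHom.injective_int _)).2 hP0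
  have hcard := card_toFinset_roots_map hn hd
  have ha := one_le_norm_leadingCoeff_map hP0
  rw [log_segmentMahlerMeasure c hQ0 hd]
  generalize (P.map (Int.castRingHom ℂ)).roots.toFinset = s at *
  generalize ‖(P.map (Int.castRingHom ℂ)).leadingCoeff‖ = a at *
  have hne : ∀ z ∈ s, ∏ w ∈ s.erase z, ‖z - w‖ ≠ 0 := fun z _ =>
    Finset.prod_ne_zero_iff.2 fun w hw =>
      (norm_pos_iff.2 (sub_ne_zero.2 (Finset.ne_of_mem_erase hw).symm)).ne'
  have hl := Real.log_nonneg hdisc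
  rw [Real.log_mul (by positivity) (Finset.prod_ne_zero_iff.2 hne), Real.log_pow,
    Real.log_prod hne, Finset.sum_congr rfl fun z hz =>
      Real.log_prod fun w hw => Finset.prod_ne_zero_iff.1 (hne z hz) w hw] at hl
  have hn0 : (2 : ℝ) ≤ n := by exact_mod_cast hn2
  -- the radius `1 - 1 / n` balances `n ^ 2 log (2 / (1 + r))` against `n log (1 / (1 - r))`
  have hr : (n : ℝ)⁻¹ ≤ 2⁻¹ := inv_anti₀ two_pos hn0
  have hr0 : 0 < (n : ℝ)⁻¹ := by positivity
  have hen := sum_log_norm_sub_le c s (r := 1 - (n : ℝ)⁻¹) (by linarith) (by linarith)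
  rw [sub_sub_cancel, inv_inv, hcard] at hen
  have hδ : Real.log (2 / (1 + (1 - (n : ℝ)⁻¹))) ≤ (n : ℝ)⁻¹ := by
    refine (Real.log_le_sub_one_of_pos (div_pos two_pos (by linarith))).trans ?_
    rw [sub_le_iff_le_add, div_le_iff₀ (by linarith)]
    nlinarith
  have hδ' : 2 * (n : ℝ) ^ 2 * Real.log (2 / (1 + (1 - (n : ℝ)⁻¹))) ≤ 2 * n := by
    calc _ ≤ 2 * (n : ℝ) ^ 2 * (n : ℝ)⁻¹ := by gcongr
      _ = 2 * n := by field_simp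
  have hla : ((2 * n - 1 : ℕ) : ℝ) * Real.log a ≤ 2 * n * Real.log a := by
    have h := Real.log_nonneg ha
    gcongr
    rw [Nat.cast_sub (by omega)]; push_cast; linarith
  generalize ∑ z ∈ s, (z - c - exteriorMap c z).re = A at *
  have hA : A ^ 2 ≤ 2 * (1 - (n : ℝ)⁻¹) * A ^ 2 := by nlinarith [sq_nonneg A]
  rw [div_pow, div_le_iff₀ (by positivity)]
  have e : 2 * ((Real.log a + ∑ z ∈ s, Real.log ‖exteriorMap c z‖) / n + 1 / n + Real.log n / n)
      * (n : ℝ) ^ 2 = 2 * n * (Real.log a + ∑ z ∈ s, Real.log ‖exteriorMap c z‖)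
        + 2 * n + 2 * n * Real.log n := by
    field_simp
  rw [e]
  nlinarith

/-! ### Coefficients -/

/-- Lower bound for a coefficient through `L`, a lower bound for the mean of the truncated zeros
`min z (c + 2)`. -/
theorem prod_le_abs_coeff_div_choose {P : ℤ[X]} {n m : ℕ} (hn : P.degree = n) (hmn : m ≤ n)
    (hn1 : 1 ≤ n)
    (hpos : ∀ z ∈ (P.map (Int.castRingHom ℂ)).roots, z ∈ posRealAxis)
    (hd : (P.map (Int.castRingHom ℂ)).roots.Nodup) {c L : ℝ} (hc : 2 ≤ c)
    (hL : L = c + 2 * ((∑ z ∈ (P.map (Int.castRingHom ℂ)).roots.toFinset,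
        (z - c - exteriorMap c z).re) / n)
      - (c + 2) * (Real.log (segmentMahlerMeasure c (P.map (Int.castRingHom ℂ))) / n))
    (hL0 : m * (c + 2) / n ≤ L) :
    ∏ j ∈ Finset.range m, (L - j * (c + 2) / n) ≤
      |(P.coeff (n - m) : ℝ)| / (n.choose m : ℝ) := by
  have hP0 : P ≠ 0 := by rintro rfl; simp at hn
  have hnat : (P.map (Int.castRingHom ℂ)).natDegree = n := natDegree_map_intCast hn
  have hQ0 : P.map (Int.castRingHom ℂ) ≠ 0 :=
    (Polynomial.map_ne_zero_iff (RingHom.injective_int _)).2 hP0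
  have hsplit := IsAlgClosed.splits (P.map (Int.castRingHom ℂ))
  have hlead := one_le_norm_leadingCoeff_map hP0
  have hcoef : |(P.coeff (n - m) : ℝ)| = ‖(P.map (Int.castRingHom ℂ)).coeff (n - m)‖ := by
    rw [coeff_map]; exact (Complex.norm_intCast _).symm
  have hcard := card_toFinset_roots_map hn hd
  have hlog := log_segmentMahlerMeasure c hQ0 hd
  rw [hcoef, coeff_eq_esymm_roots_of_splits hsplit (by omega), hnat, Nat.sub_sub_self hmn]
  have hval : (P.map (Int.castRingHom ℂ)).roots =
      (P.map (Int.castRingHom ℂ)).roots.toFinset.val.map id := by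
    rw [Multiset.map_id, Multiset.toFinset_val, hd.dedup]
  have hpos' : ∀ z ∈ (P.map (Int.castRingHom ℂ)).roots.toFinset, ∃ x : ℝ, 0 < x ∧ (x : ℂ) = z :=
    fun z hz => hpos z (Multiset.mem_toFinset.1 hz)
  rw [hval, Finset.esymm_map_val]
  have hla := Real.log_nonneg hlead
  generalize (P.map (Int.castRingHom ℂ)).roots.toFinset = s at *
  generalize (P.map (Int.castRingHom ℂ)).leadingCoeff = a at *
  rw [norm_mul, norm_mul, norm_pow, norm_neg, norm_one, one_pow, mul_one]
  have hn0 : (0 : ℝ) < n := by exact_mod_cast hn1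
  -- Truncation makes the zeros bounded, and can only decrease their elementary symmetric sums.
  set b : ℂ → ℝ := fun z => min z.re (c + 2) with hb
  have hb0 : ∀ z ∈ s, 0 ≤ b z := fun z hz => by
    obtain ⟨x, hx, rfl⟩ := hpos' z hz
    exact le_min hx.le (by linarith)
  have hbT : ∀ z ∈ s, b z ≤ c + 2 := fun z _ => min_le_right _ _
  have hS : n * L ≤ ∑ z ∈ s, b z := by
    have h1 : ∑ z ∈ s, (c + 2 * (z - c - exteriorMap c z).re
        - (c + 2) * Real.log ‖exteriorMap c z‖) ≤ ∑ z ∈ s, b z := by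
      refine Finset.sum_le_sum fun z hz => ?_
      obtain ⟨x, hx, rfl⟩ := hpos' z hz
      exact add_two_mul_re_sub_le_min (by linarith) hx
    rw [Finset.sum_sub_distrib, Finset.sum_add_distrib, Finset.sum_const, hcard, nsmul_eq_mul,
      ← Finset.mul_sum, ← Finset.mul_sum] at h1
    refine le_trans ?_ h1
    rw [hL, hlog]
    have e : (n : ℝ) * (c + 2 * ((∑ z ∈ s, (z - c - exteriorMap c z).re) / n)
        - (c + 2) * ((Real.log ‖a‖ + ∑ z ∈ s, Real.log ‖exteriorMap c z‖) / n)) =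
        n * c + 2 * (∑ z ∈ s, (z - c - exteriorMap c z).re)
        - (c + 2) * (Real.log ‖a‖ + ∑ z ∈ s, Real.log ‖exteriorMap c z‖) := by
      field_simp
    rw [e]
    nlinarith
  have hfac : ∀ j < m, 0 ≤ n * (L - j * (c + 2) / n) ∧
      n * (L - j * (c + 2) / n) ≤ ∑ z ∈ s, b z - j * (c + 2) := by
    intro j hj
    have hjm : (j : ℝ) ≤ m := by exact_mod_cast hj.le
    refine ⟨mul_nonneg hn0.le (sub_nonneg.2 (le_trans ?_ hL0)), ?_⟩
    · gcongr
    · rw [mul_sub, mul_div_cancel₀ _ hn0.ne']; linarith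
  have key := prod_sum_sub_le_factorial_mul s hb0 hbT m fun j hj => (hfac j hj).1.trans (hfac j hj).2
  have hprod : (n : ℝ) ^ m * ∏ j ∈ Finset.range m, (L - j * (c + 2) / n) ≤
      ∏ j ∈ Finset.range m, (∑ z ∈ s, b z - j * (c + 2)) := by
    calc _ = ∏ j ∈ Finset.range m, (n * (L - j * (c + 2) / n)) := by
          rw [Finset.prod_mul_distrib, Finset.prod_const, Finset.card_range]
      _ ≤ _ := Finset.prod_le_prod (fun j hj => (hfac j (Finset.mem_range.1 hj)).1)
          fun j hj => (hfac j (Finset.mem_range.1 hj)).2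
  have hesymm : ∑ t ∈ s.powersetCard m, ∏ z ∈ t, b z ≤
      ‖∑ t ∈ s.powersetCard m, ∏ z ∈ t, id z‖ := by
    have e : ∑ t ∈ s.powersetCard m, ∏ z ∈ t, id z =
        ((∑ t ∈ s.powersetCard m, ∏ z ∈ t, z.re : ℝ) : ℂ) := by
      push_cast
      refine Finset.sum_congr rfl fun t ht => Finset.prod_congr rfl fun z hz => ?_
      obtain ⟨x, hx, rfl⟩ := hpos' z ((Finset.mem_powersetCard.1 ht).1 hz)
      simp
    rw [e, Complex.norm_real]
    refine le_trans ?_ (le_abs_self _)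
    refine Finset.sum_le_sum fun t ht => Finset.prod_le_prod (fun z hz => ?_) fun z _ =>
      min_le_left _ _
    exact hb0 z ((Finset.mem_powersetCard.1 ht).1 hz)
  have hch : (0 : ℝ) < n.choose m := by exact_mod_cast Nat.choose_pos hmn
  have hpow : (m.factorial : ℝ) * n.choose m ≤ (n : ℝ) ^ m := by
    rw [← Nat.cast_mul, ← Nat.descFactorial_eq_factorial_mul_choose]
    exact_mod_cast Nat.descFactorial_le_pow n m
  have hprod0 : 0 ≤ ∏ j ∈ Finset.range m, (L - j * (c + 2) / n) := Finset.prod_nonneg fun j hj =>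
    nonneg_of_mul_nonneg_right (hfac j (Finset.mem_range.1 hj)).1 hn0
  rw [le_div_iff₀ hch]
  have hf : (0 : ℝ) < m.factorial := by exact_mod_cast Nat.factorial_pos m
  refine le_of_mul_le_mul_left ?_ hf
  calc (m.factorial : ℝ) * ((∏ j ∈ Finset.range m, (L - j * (c + 2) / n)) * n.choose m)
      = (m.factorial * n.choose m) * ∏ j ∈ Finset.range m, (L - j * (c + 2) / n) := by ring
    _ ≤ n ^ m * ∏ j ∈ Finset.range m, (L - j * (c + 2) / n) := by gcongr
    _ ≤ m.factorial * ∑ t ∈ s.powersetCard m, ∏ z ∈ t, b z := hprod.trans key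
    _ ≤ m.factorial * (‖a‖ * ‖∑ t ∈ s.powersetCard m, ∏ z ∈ t, id z‖) := by
        gcongr
        exact hesymm.trans (le_mul_of_one_le_left (norm_nonneg _) hlead)

theorem theorem2p9 (c : ℝ) (hc : 2 ≤ c) (P : ℕ → ℤ[X])
    (hP : ∀ n : ℕ, 1 ≤ n → P n ∈ simpleZeroIntPolys n posRealAxis)
    (hM : Filter.Tendsto
      (fun n : ℕ => segmentMahlerMeasure c ((P n).map (Int.castRingHom ℂ)) ^ (1 / (n : ℝ)))
      Filter.atTop (nhds 1))
    (m : ℕ) (hm : 1 ≤ m) :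
    ((c ^ m : ℝ) : EReal) ≤
        Filter.liminf
          (fun n : ℕ => ((|((P n).coeff (n - m) : ℝ)| / (n.choose m : ℝ) : ℝ) : EReal))
          Filter.atTop ∧
      (2 : ℝ) ^ m ≤ c ^ m := by
  refine ⟨?_, pow_le_pow_left₀ zero_le_two hc m⟩
  have hlogM : Filter.Tendsto (fun n : ℕ =>
      Real.log (segmentMahlerMeasure c ((P n).map (Int.castRingHom ℂ))) / n)
      Filter.atTop (nhds 0) := by
    have h := hM.log one_ne_zero
    rw [Real.log_one] at h
    refine h.congr' ?_
    filter_upwards [Filter.eventually_ge_atTop 1] with n hn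
    have h0 : (P n).map (Int.castRingHom ℂ) ≠ 0 := by
      rw [Polynomial.map_ne_zero_iff (RingHom.injective_int _)]
      intro h
      have := (hP n hn).1
      simp [h] at this
    rw [Real.log_rpow, one_div_mul_eq_div]
    rw [segmentMahlerMeasure_eq_prod_roots]
    refine mul_pos (by simpa using h0) ?_
    refine Multiset.prod_induction (0 < ·) _ (fun _ _ => mul_pos) one_pos fun x hx => ?_
    obtain ⟨z, -, rfl⟩ := Multiset.mem_map.1 hx
    exact zero_lt_one.trans_le (norm_sub_exteriorMap_le_one_and c z).2.1
  have hinv : Filter.Tendsto (fun n : ℕ => 1 / (n : ℝ)) Filter.atTop (nhds 0) :=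
    tendsto_one_div_atTop_nhds_zero_nat
  have hlogn : Filter.Tendsto (fun n : ℕ => Real.log n / n) Filter.atTop (nhds 0) :=
    Real.isLittleO_log_id_atTop.tendsto_div_nhds_zero.comp tendsto_natCast_atTop_atTop
  have hmean : Filter.Tendsto (fun n : ℕ =>
      (∑ z ∈ ((P n).map (Int.castRingHom ℂ)).roots.toFinset,
        (z - c - exteriorMap c z).re) / n) Filter.atTop (nhds 0) := by
    have h1 := ((hlogM.add hinv).add hlogn).const_mul 2
    simp only [add_zero, mul_zero] at h1
    have h2 := squeeze_zero' (Filter.Eventually.of_forall fun n => sq_nonneg _)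
      (by
        filter_upwards [Filter.eventually_ge_atTop 2] with n hn
        obtain ⟨hdeg, -, hd⟩ := hP n (by omega)
        exact sq_sum_re_div_le c hdeg hn hd) h1
    have h3 := h2.sqrt
    simp only [Real.sqrt_sq_eq_abs, Real.sqrt_zero] at h3
    exact (tendsto_zero_iff_abs_tendsto_zero _).2 h3
  have hL := ((hmean.const_mul 2).const_add c).sub (hlogM.const_mul (c + 2))
  simp only [mul_zero, add_zero, sub_zero] at hL
  have hj : ∀ j : ℕ, Filter.Tendsto (fun n : ℕ => j * (c + 2) / (n : ℝ)) Filter.atTop (nhds 0) :=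
    fun j => tendsto_const_div_atTop_nhds_zero_nat _
  have hprod := tendsto_finsetProd (Finset.range m) fun j _ => hL.sub (hj j)
  simp only [sub_zero, Finset.prod_const, Finset.card_range] at hprod
  rw [← ((continuous_coe_real_ereal.tendsto _).comp hprod).liminf_eq]
  refine Filter.liminf_le_liminf ?_
  have hev := (hj m).eventually_lt hL (by linarith)
  filter_upwards [hev, Filter.eventually_ge_atTop (max m 1)] with n hn hmn
  obtain ⟨hdeg, hpos, hd⟩ := hP n ((le_max_right _ _).trans hmn)
  exact EReal.coe_le_coe_iff.2 (prod_le_abs_coeff_div_choose hdeg ((le_max_left _ _).trans hmn)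
    ((le_max_right _ _).trans hmn) hpos hd hc rfl hn.le)
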